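/- A language is prefix-free if no proper prefix of a string in the language is itself in the language. For a language $L$ over an alphabet $\Sigma$, let $\mathrm{nsc}(L)$ be the least number of states of a nondeterministic finite automaton with a single initial state that accepts $L$ (and $\mathrm{nsc}(L)=\infty$ if there is no such automaton). Let $m,n\ge 3$. Then: 1. If $K,L$ are prefix-free languages over a common alphabet with $\mathrm{nsc}(K)=m$ and $\mathrm{nsc}(L)=n$, then $\mathrm{nsc}(K\cup L)\le m+n$; and there are such $K,L$ over a two-letter alphabet with $\mathrm{nsc}(K\cup L)=m+n$. 2. If $K,L$ are prefix-free languages over a common alphabet with $\mathrm{nsc}(K)=m$ and $\mathrm{nsc}(L)=n$, then $\mathrm{nsc}(K\cap L)\le mn-(m+n)+2$; and there are such $K,L$ over a two-letter alphabet with $\mathrm{nsc}(K\cap L)=mn-(m+n)+2$. 3. If $L$ is a prefix-free language over an alphabet $\Sigma$ with $\mathrm{nsc}(L)=n$ and $L^c=\Sigma^*\setminus L$, then $\mathrm{nsc}(L^c)\le 2^{n-1}$; and there is such an $L$ over a three-letter alphabet with $\mathrm{nsc}(L^c)=2^{n-1}$. 4. If $K,L$ are prefix-free languages over a common alphabet with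 $\mathrm{nsc}(K)=m$ and $\mathrm{nsc}(L)=n$, then $\mathrm{nsc}(K\setminus L)\le (m-1)2^{n-1}+1$; and there are such $K,L$ over a four-letter alphabet with $\mathrm{nsc}(K\setminus L)=(m-1)2^{n-1}+1$. -/

import Mathlib

/-- A language is prefix-free if no proper prefix of a string in the language is in the language. -/
def Language.PrefixFree {α : Type*} (L : Language α) : Prop :=
  ∀ x ∈ L, ∀ y : List α, y <+: x → y ≠ x → y ∉ L

/-- `L` is accepted by a nondeterministic finite automaton that has exactly `k` states,
of which exactly one is initial. -/
def Language.IsAcceptedByNFA {α : Type*} (L : Language α) (k : ℕ) : Prop :=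
  ∃ M : NFA α (Fin k), (∃ s : Fin k, M.start = {s}) ∧ M.accepts = L

/-- The nondeterministic state complexity of `L`: the least number of states of a nondeterministic
finite automaton with a single initial state that accepts `L`
(it is `⊤` if there is none, that is, if `L` is not regular). -/
noncomputable def Language.nsc {α : Type*} (L : Language α) : ℕ∞ :=
  ⨅ (k : ℕ) (_ : L.IsAcceptedByNFA k), (k : ℕ∞)

/-! Upper bounds. In a prefix-free language no accepted word has an accepted proper extension, so a
minimal automaton may be given a single accepting state without outgoing transitions
(`PrefixFreeNFA`). An automaton with `n` states then has at most `n - 1` working states. For union,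
take the working states of both automata, a fresh initial state and one shared final state. For
intersection, take pairs of working states and one final state: a pair with just one final component
is dead. For difference, pair a working state of the first automaton with the set of working states
reached in the second, and add one final state. For complement, sets of working states suffice. The
empty set must serve both just after a word of the language, where it must reject, and after a dead
end, where it must accept; nondeterminism resolves this conflict.

Lower bounds. These come from fooling sets: pairs `(x i, y i)` with `x i ++ y i` in the language,
such that for `i ≠ j` one of the crossed words is not. A prefix-free language gains one state from
the pair (accepted word, empty word), and the union one more because the initial state realises no
pair. The witnesses rotate `ZMod k`. Counting letters separates the pairs for intersection; for
complement and difference, `ZMod.merge_induction` makes every set of states reachable and every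
nonempty one co-reachable, so that crossed words compare sets by inclusion. -/

namespace NFA

variable {α : Type*} {σ τ : Type*}

/-- `M.AccFrom q w` says that some run of `M` on `w` leads from the state `q` to acceptance. -/
def AccFrom (M : NFA α σ) (q : σ) (w : List α) : Prop :=
  w ∈ M.acceptsFrom {q}

theorem accFrom_nil {M : NFA α σ} {q : σ} : M.AccFrom q [] ↔ q ∈ M.accept := by
  simp [AccFrom]

theorem mem_acceptsFrom_iff_exists_accFrom {M : NFA α σ} {S : Set σ} {w : List α} :
    w ∈ M.acceptsFrom S ↔ ∃ q ∈ S, M.AccFrom q w := by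
  simp only [AccFrom, mem_acceptsFrom]
  constructor
  · rintro ⟨s, hs, h⟩
    obtain ⟨t, ht, h⟩ := mem_evalFrom_iff_exists.1 h
    exact ⟨t, ht, s, hs, h⟩
  · rintro ⟨t, ht, s, hs, h⟩
    exact ⟨s, hs, mem_evalFrom_iff_exists.2 ⟨t, ht, h⟩⟩

theorem accFrom_cons {M : NFA α σ} {q : σ} {a : α} {w : List α} :
    M.AccFrom q (a :: w) ↔ ∃ t ∈ M.step q a, M.AccFrom t w := by
  rw [AccFrom, cons_mem_acceptsFrom, stepSet_singleton, mem_acceptsFrom_iff_exists_accFrom]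

theorem accFrom_append {M : NFA α σ} {q : σ} {v w : List α} :
    M.AccFrom q (v ++ w) ↔ ∃ t ∈ M.evalFrom {q} v, M.AccFrom t w := by
  rw [AccFrom, append_mem_acceptsFrom, mem_acceptsFrom_iff_exists_accFrom]

theorem mem_accepts_iff_accFrom {M : NFA α σ} {s : σ} (hs : M.start = {s}) {w : List α} :
    w ∈ M.accepts ↔ M.AccFrom s w := by
  rw [accepts_eq_acceptsFrom_start, hs, AccFrom]

/-- Serves to relabel states and to embed a component automaton in a larger one; since `N.step (f q)
a` is exactly the image, runs never leave the range of `f`. -/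
theorem accFrom_map_iff {M : NFA α σ} {N : NFA α τ} {f : σ → τ}
    (hstep : ∀ q a, N.step (f q) a = f '' M.step q a)
    (hacc : ∀ q, f q ∈ N.accept ↔ q ∈ M.accept) {q : σ} {w : List α} :
    N.AccFrom (f q) w ↔ M.AccFrom q w := by
  induction w generalizing q with
  | nil => simp only [accFrom_nil, hacc]
  | cons a w ih =>
    simp only [accFrom_cons, hstep, Set.exists_mem_image, ih]

/-- The accepting states of `M` have no outgoing transitions. -/
def AcceptTerminal (M : NFA α σ) : Prop :=
  ∀ q ∈ M.accept, ∀ a, M.step q a = ∅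

theorem AcceptTerminal.accFrom_iff {M : NFA α σ} (hM : M.AcceptTerminal) {q : σ}
    (hq : q ∈ M.accept) {w : List α} : M.AccFrom q w ↔ w = [] := by
  cases w with
  | nil => simp [accFrom_nil, hq]
  | cons a w => simp [accFrom_cons, hM q hq]

end NFA

/-! ### State complexity and fooling sets -/

namespace Language

variable {α : Type*}

theorem nsc_le_of_isAcceptedByNFA {L : Language α} {k : ℕ} (h : L.IsAcceptedByNFA k) :
    L.nsc ≤ k :=
  iInf₂_le k h

theorem nsc_le_of_nfa {L : Language α} {σ : Type*} [Fintype σ] (M : NFA α σ) (s : σ)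
    (hL : ∀ w, M.AccFrom s w ↔ w ∈ L) {k : ℕ} (hk : Fintype.card σ ≤ k) :
    L.nsc ≤ k := by
  let e := Fintype.equivFin σ
  let N : NFA α (Fin (Fintype.card σ)) :=
    { step := fun i a => e '' M.step (e.symm i) a
      start := {e s}
      accept := e '' M.accept }
  have hN : ∀ w, N.AccFrom (e s) w ↔ M.AccFrom s w := fun w =>
    NFA.accFrom_map_iff (by simp [N]) (by simp [N])
  refine le_trans (nsc_le_of_isAcceptedByNFA (k := Fintype.card σ) ⟨N, ⟨e s, rfl⟩, ?_⟩)
    (by exact_mod_cast hk)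
  ext w
  rw [NFA.mem_accepts_iff_accFrom (s := e s) rfl, hN, hL]

theorem isAcceptedByNFA_of_nsc_eq {L : Language α} {m : ℕ} (h : L.nsc = m) :
    L.IsAcceptedByNFA m := by
  by_contra hm
  have : ((m + 1 : ℕ) : ℕ∞) ≤ L.nsc := by
    refine le_iInf₂ fun k hk => ?_
    have h1 := nsc_le_of_isAcceptedByNFA hk
    rw [h] at h1
    have h2 : m ≤ k := by exact_mod_cast h1
    have h3 : m ≠ k := fun e => hm (e ▸ hk)
    exact_mod_cast (by omega : m + 1 ≤ k)
  rw [h] at this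
  have : m + 1 ≤ m := by exact_mod_cast this
  omega

theorem le_nsc_of_forall_nfa {L : Language α} {N : ℕ}
    (h : ∀ (k : ℕ) (M : NFA α (Fin k)) (s : Fin k), (∀ w, w ∈ L ↔ M.AccFrom s w) → N ≤ k) :
    (N : ℕ∞) ≤ L.nsc := by
  refine le_iInf₂ fun k hk => ?_
  obtain ⟨M, ⟨s, hs⟩, rfl⟩ := hk
  exact_mod_cast h k M s fun w => NFA.mem_accepts_iff_accFrom hs

/-- The extended fooling set bound. -/
theorem card_le_nsc_of_fooling {L : Language α} {ι : Type*} [Fintype ι] (x y : ι → List α)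
    (hxy : ∀ i, x i ++ y i ∈ L)
    (hne : ∀ i j, x i ++ y j ∈ L → x j ++ y i ∈ L → i = j) :
    (Fintype.card ι : ℕ∞) ≤ L.nsc := by
  refine le_nsc_of_forall_nfa fun k M s hM => ?_
  have h1 : ∀ i, ∃ t ∈ M.evalFrom {s} (x i), M.AccFrom t (y i) := fun i =>
    NFA.accFrom_append.1 ((hM _).1 (hxy i))
  choose p hp hp' using h1
  have hinj : Function.Injective p := fun i j hij => by
    refine hne i j ((hM _).2 (NFA.accFrom_append.2 ⟨p i, hp i, hij ▸ hp' j⟩))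
      ((hM _).2 (NFA.accFrom_append.2 ⟨p j, hp j, hij ▸ hp' i⟩))
  simpa using Fintype.card_le_of_injective p hinj

/-- A fooling set none of whose states can be the initial one gives one more state. -/
theorem card_succ_le_nsc_of_fooling {L : Language α} {ι : Type*} [Fintype ι] (x y : ι → List α)
    (hxy : ∀ i, x i ++ y i ∈ L)
    (hne : ∀ i j, x i ++ y j ∈ L → x j ++ y i ∈ L → i = j)
    (hinit : ∀ i, y i ∈ L → ∃ u ∈ L, x i ++ u ∉ L) :
    ((Fintype.card ι + 1 : ℕ) : ℕ∞) ≤ L.nsc := by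
  refine le_nsc_of_forall_nfa fun k M s hM => ?_
  have h1 : ∀ i, ∃ t ∈ M.evalFrom {s} (x i), M.AccFrom t (y i) := fun i =>
    NFA.accFrom_append.1 ((hM _).1 (hxy i))
  choose p hp hp' using h1
  -- If the initial state realised pair `i`, then `y i` would be in `L`, and `x i` could be put
  -- before every word of `L`.
  have hs : ∀ i, p i ≠ s := fun i hi => by
    obtain ⟨u, hu, hxu⟩ := hinit i ((hM _).2 (hi ▸ hp' i))
    exact hxu ((hM _).2 (NFA.accFrom_append.2 ⟨p i, hp i, hi.symm ▸ (hM _).1 hu⟩))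
  have hinj : Function.Injective (fun o : Option ι => o.elim s p) := by
    rintro (_ | i) (_ | j) hij
    · rfl
    · exact absurd hij.symm (hs j)
    · exact absurd hij (hs i)
    · exact congrArg some (hne i j
        ((hM _).2 (NFA.accFrom_append.2 ⟨p i, hp i, (show p i = p j from hij) ▸ hp' j⟩))
        ((hM _).2 (NFA.accFrom_append.2 ⟨p j, hp j, (show p i = p j from hij) ▸ hp' i⟩)))
  simpa using Fintype.card_le_of_injective _ hinj

theorem PrefixFree.append_notMem {L : Language α} (hL : L.PrefixFree) {x y : List α}
    (hx : x ∈ L) (hy : y ≠ []) : x ++ y ∉ L := fun h =>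
  hL _ h x (List.prefix_append x y) (by simpa using hy) hx

theorem PrefixFree.mono {K L : Language α} (hL : L.PrefixFree) (h : ∀ w ∈ K, w ∈ L) :
    K.PrefixFree :=
  fun x hx y hxy hne hy => hL x (h x hx) y hxy hne (h y hy)

/-- For a prefix-free language, the accepting state is not counted by a fooling set with nonempty
second components. -/
theorem PrefixFree.card_succ_le_nsc {L : Language α} (hL : L.PrefixFree) {ι : Type*} [Fintype ι]
    [Nonempty ι] (x y : ι → List α) (hy : ∀ i, y i ≠ [])
    (hxy : ∀ i, x i ++ y i ∈ L)
    (hne : ∀ i j, x i ++ y j ∈ L → x j ++ y i ∈ L → i = j) :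
    ((Fintype.card ι + 1 : ℕ) : ℕ∞) ≤ L.nsc := by
  let i₀ : ι := Classical.arbitrary ι
  -- The extra pair is `(x i₀ ++ y i₀, [])`; by prefix-freeness no nonempty `y j` can follow its
  -- first component.
  have := card_le_nsc_of_fooling (L := L) (ι := Option ι)
    (fun o => o.elim (x i₀ ++ y i₀) x) (fun o => o.elim [] y) ?_ ?_
  · simpa using this
  · rintro (_ | i)
    · simpa using hxy i₀
    · exact hxy i
  · rintro (_ | i) (_ | j) h1 h2
    · rfl
    · exact absurd h1 (hL.append_notMem (hxy i₀) (hy j))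
    · exact absurd h2 (hL.append_notMem (hxy i₀) (hy i))
    · exact congrArg some (hne i j h1 h2)

/-! ### Normal form for prefix-free languages -/

/-- The normal form of a nondeterministic automaton for a prefix-free language: its only accepting
state `none` has no outgoing transitions. -/
structure PrefixFreeNFA (L : Language α) (k : ℕ) where
  /-- The non-accepting states. -/
  Q : Type
  [fintypeQ : Fintype Q]
  card_le : Fintype.card Q + 1 ≤ k
  /-- The automaton. -/
  nfa : NFA α (Option Q)
  /-- The initial state. -/
  init : Q
  accept_eq : nfa.accept = {none}
  step_none : ∀ a, nfa.step none a = ∅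
  accFrom_init : ∀ w, nfa.AccFrom (some init) w ↔ w ∈ L

attribute [instance] PrefixFreeNFA.fintypeQ

theorem PrefixFreeNFA.accFrom_none {L : Language α} {k : ℕ} (M : L.PrefixFreeNFA k)
    {w : List α} : M.nfa.AccFrom none w ↔ w = [] :=
  NFA.AcceptTerminal.accFrom_iff
    (fun q hq a => by
      rw [M.accept_eq, Set.mem_singleton_iff] at hq
      rw [hq, M.step_none]) (by simp [M.accept_eq])

theorem PrefixFree.nonempty_prefixFreeNFA {L : Language α} (hL : L.PrefixFree) {n : ℕ}
    (hn : 2 ≤ n) (h : L.nsc = n) : Nonempty (L.PrefixFreeNFA n) := by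
  obtain ⟨M, ⟨s, hs⟩, rfl⟩ := isAcceptedByNFA_of_nsc_eq h
  have hlt : ∀ k < n, ¬ M.accepts.nsc ≤ (k : ℕ) := fun k hk hle => by
    rw [h] at hle
    have : n ≤ k := by exact_mod_cast hle
    omega
  -- The empty language and the language of the empty word need one state only, so `2 ≤ n` rules out
  -- both degenerate cases.
  by_cases hne : M.accept = ∅
  · refine absurd ?_ (hlt 1 (by omega))
    refine nsc_le_of_nfa (σ := Unit) ⟨fun _ _ => ∅, {()}, ∅⟩ () (fun w => ?_) (by simp)
    have : w ∉ M.accepts := by simp [NFA.mem_accepts, hne]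
    cases w <;> simp [NFA.accFrom_nil, NFA.accFrom_cons, this]
  have hsa : s ∉ M.accept := fun hsa => by
    refine absurd ?_ (hlt 1 (by omega))
    refine nsc_le_of_nfa (σ := Unit) ⟨fun _ _ => ∅, {()}, {()}⟩ () (fun w => ?_) (by simp)
    have h0 : [] ∈ M.accepts := by
      rwa [NFA.mem_accepts_iff_accFrom hs, NFA.accFrom_nil]
    cases w with
    | nil => simp [NFA.accFrom_nil, h0]
    | cons a w =>
      have := hL.append_notMem h0 (List.cons_ne_nil a w)
      simp only [List.nil_append] at this
      simp [NFA.accFrom_cons, this]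
  classical
  let Q := {q : Fin n // q ∉ M.accept}
  -- All accepting states are merged into `none` and their outgoing transitions dropped.
  let N : NFA α (Option Q) :=
    { step := fun o a => o.elim ∅ fun q =>
        {t | t.elim (∃ t ∈ M.step q a, t ∈ M.accept) fun t => (t : Fin n) ∈ M.step q a}
      start := {some ⟨s, hsa⟩}
      accept := {none} }
  have hN : N.AcceptTerminal := by
    rintro q hq a
    rw [show q = none from hq]
    rfl
  -- The hypothesis says that the language accepted from `q` is prefix-free. It passes to
  -- successors, and it shows that a dropped transition could not have led to acceptance.
  have key : ∀ (w : List α) (q : Q), (∀ u v, M.AccFrom q u → M.AccFrom q (u ++ v) → v = []) →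
      (N.AccFrom (some q) w ↔ M.AccFrom q w) := by
    intro w
    induction w with
    | nil =>
      intro q _
      rw [NFA.accFrom_nil, NFA.accFrom_nil]
      simp [N, q.2]
    | cons a w ih =>
      intro q hq
      rw [NFA.accFrom_cons, NFA.accFrom_cons]
      constructor
      · rintro ⟨_ | t, ht, hw⟩
        · rw [hN.accFrom_iff rfl] at hw
          obtain ⟨t, ht, hta⟩ := ht
          exact ⟨t, ht, by rw [hw, NFA.accFrom_nil]; exact hta⟩
        · refine ⟨t, ht, (ih t fun u v h1 h2 => ?_).1 hw⟩
          exact hq (a :: u) v (NFA.accFrom_cons.2 ⟨t, ht, h1⟩) (NFA.accFrom_cons.2 ⟨t, ht, h2⟩)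
      · rintro ⟨t, ht, hw⟩
        by_cases hta : t ∈ M.accept
        · have : w = [] := hq [a] w
            (NFA.accFrom_cons.2 ⟨t, ht, NFA.accFrom_nil.2 hta⟩) (NFA.accFrom_cons.2 ⟨t, ht, hw⟩)
          exact ⟨none, ⟨t, ht, hta⟩, by rw [hN.accFrom_iff rfl, this]⟩
        · refine ⟨some ⟨t, hta⟩, ht, (ih ⟨t, hta⟩ fun u v h1 h2 => ?_).2 hw⟩
          exact hq (a :: u) v (NFA.accFrom_cons.2 ⟨t, ht, h1⟩) (NFA.accFrom_cons.2 ⟨t, ht, h2⟩)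
  refine ⟨{ Q := Q, card_le := ?_, nfa := N, init := ⟨s, hsa⟩, accept_eq := rfl,
            step_none := fun a => rfl, accFrom_init := fun w => ?_ }⟩
  · obtain ⟨t, ht⟩ := Set.nonempty_iff_ne_empty.2 hne
    have := Fintype.card_subtype_lt (p := fun q : Fin n => q ∉ M.accept) (x := t) (by simpa using ht)
    rw [Fintype.card_fin] at this
    exact this
  · rw [NFA.mem_accepts_iff_accFrom hs]
    refine key w _ fun u v h1 h2 => ?_
    by_contra hv
    exact hL.append_notMem ((NFA.mem_accepts_iff_accFrom hs).2 h1) hv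
      ((NFA.mem_accepts_iff_accFrom hs).2 h2)

/-! ### Upper bounds -/

theorem PrefixFreeNFA.nsc_sup_le {K L : Language α} {m n : ℕ} (M : K.PrefixFreeNFA m)
    (N : L.PrefixFreeNFA n) : (K ⊔ L).nsc ≤ (m + n : ℕ) := by
  let f : Option M.Q → Option (Option (M.Q ⊕ N.Q)) := Option.map fun q => some (.inl q)
  let g : Option N.Q → Option (Option (M.Q ⊕ N.Q)) := Option.map fun q => some (.inr q)
  -- `none` is the shared final state, `some none` the fresh initial one: at most `(m - 1) + (n - 1)
  -- + 2` states.
  let U : NFA α (Option (Option (M.Q ⊕ N.Q))) :=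
    { step := fun o a => match o with
        | none => ∅
        | some none => f '' M.nfa.step (some M.init) a ∪ g '' N.nfa.step (some N.init) a
        | some (some (.inl q)) => f '' M.nfa.step (some q) a
        | some (some (.inr q)) => g '' N.nfa.step (some q) a
      start := {some none}
      accept := {none} }
  have hf : ∀ q w, U.AccFrom (f q) w ↔ M.nfa.AccFrom q w := fun q w => by
    refine NFA.accFrom_map_iff (fun q a => ?_) (fun q => ?_)
    · cases q <;> simp [f, U, M.step_none]
    · cases q <;> simp [f, U, M.accept_eq]
  have hg : ∀ q w, U.AccFrom (g q) w ↔ N.nfa.AccFrom q w := fun q w => by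
    refine NFA.accFrom_map_iff (fun q a => ?_) (fun q => ?_)
    · cases q <;> simp [g, U, N.step_none]
    · cases q <;> simp [g, U, N.accept_eq]
  refine nsc_le_of_nfa U (some none) (fun w => ?_) ?_
  · have : w ∈ K ⊔ L ↔ w ∈ K ∨ w ∈ L := Iff.rfl
    rw [this, ← M.accFrom_init, ← N.accFrom_init]
    cases w with
    | nil => simp [NFA.accFrom_nil, U, M.accept_eq, N.accept_eq]
    | cons a w =>
      simp only [NFA.accFrom_cons]
      simp only [U, Set.mem_union, or_and_right, exists_or, Set.exists_mem_image]
      exact or_congr (exists_congr fun q => and_congr_right fun _ => hf q w)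
        (exists_congr fun q => and_congr_right fun _ => hg q w)
  · have := M.card_le
    have := N.card_le
    simp only [Fintype.card_option, Fintype.card_sum]
    omega

theorem PrefixFreeNFA.nsc_inf_le {K L : Language α} {m n : ℕ} (M : K.PrefixFreeNFA m)
    (N : L.PrefixFreeNFA n) : (K ⊓ L).nsc ≤ ((m - 1) * (n - 1) + 1 : ℕ) := by
  let U : NFA α (Option (M.Q × N.Q)) :=
    { step := fun o a => match o with
        | none => ∅
        | some (p, q) => {t | match t with
          | none => none ∈ M.nfa.step (some p) a ∧ none ∈ N.nfa.step (some q) a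
          | some (p', q') => some p' ∈ M.nfa.step (some p) a ∧ some q' ∈ N.nfa.step (some q) a}
      start := {some (M.init, N.init)}
      accept := {none} }
  have hU : U.AcceptTerminal := by
    rintro q hq a
    rw [show q = none from hq]
  have key : ∀ w p q, U.AccFrom (some (p, q)) w ↔
      M.nfa.AccFrom (some p) w ∧ N.nfa.AccFrom (some q) w := by
    intro w
    induction w with
    | nil => simp [NFA.accFrom_nil, U, M.accept_eq, N.accept_eq]
    | cons a w ih =>
      intro p q
      simp only [NFA.accFrom_cons]
      constructor
      · rintro ⟨_ | ⟨p', q'⟩, ht, hw⟩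
        · rw [hU.accFrom_iff rfl] at hw
          exact ⟨⟨none, ht.1, M.accFrom_none.2 hw⟩, ⟨none, ht.2, N.accFrom_none.2 hw⟩⟩
        · rw [ih] at hw
          exact ⟨⟨some p', ht.1, hw.1⟩, ⟨some q', ht.2, hw.2⟩⟩
      · rintro ⟨⟨_ | p', hp, hwp⟩, ⟨_ | q', hq, hwq⟩⟩
        · exact ⟨none, ⟨hp, hq⟩, (hU.accFrom_iff rfl).2 (M.accFrom_none.1 hwp)⟩
        -- One run has ended, so the remaining word is empty, while the other run is still in a
        -- working state and cannot accept.
        · rw [M.accFrom_none] at hwp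
          simp [hwp, NFA.accFrom_nil, N.accept_eq] at hwq
        · rw [N.accFrom_none] at hwq
          simp [hwq, NFA.accFrom_nil, M.accept_eq] at hwp
        · exact ⟨some (p', q'), ⟨hp, hq⟩, (ih p' q').2 ⟨hwp, hwq⟩⟩
  refine nsc_le_of_nfa U (some (M.init, N.init)) (fun w => ?_) ?_
  · rw [key, M.accFrom_init, N.accFrom_init]
    rfl
  · have h1 := M.card_le
    have h2 := N.card_le
    simp only [Fintype.card_option, Fintype.card_prod]
    gcongr <;> omega

theorem PrefixFreeNFA.nsc_sdiff_le {K L : Language α} {m n : ℕ} (M : K.PrefixFreeNFA m)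
    (N : L.PrefixFreeNFA n) : (K \ L).nsc ≤ ((m - 1) * 2 ^ (n - 1) + 1 : ℕ) := by
  classical
  -- The final state of `N` need not be recorded in the sets: it matters only at the last letter,
  -- when it must be avoided.
  let U : NFA α (Option (M.Q × Set N.Q)) :=
    { step := fun o a => match o with
        | none => ∅
        | some (p, S) => {t | match t with
          | none => none ∈ M.nfa.step (some p) a ∧ ∀ q ∈ S, none ∉ N.nfa.step (some q) a
          | some (p', S') => some p' ∈ M.nfa.step (some p) a ∧
              S' = {q' | ∃ q ∈ S, some q' ∈ N.nfa.step (some q) a}}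
      start := {some (M.init, {N.init})}
      accept := {none} }
  have hU : U.AcceptTerminal := by
    rintro q hq a
    rw [show q = none from hq]
  have key : ∀ w p S, U.AccFrom (some (p, S)) w ↔
      M.nfa.AccFrom (some p) w ∧ ∀ q ∈ S, ¬ N.nfa.AccFrom (some q) w := by
    intro w
    induction w with
    | nil => simp [NFA.accFrom_nil, U, M.accept_eq]
    | cons a w ih =>
      intro p S
      simp only [NFA.accFrom_cons]
      constructor
      · rintro ⟨_ | ⟨p', S'⟩, ht, hw⟩
        · rw [hU.accFrom_iff rfl] at hw
          subst hw
          refine ⟨⟨none, ht.1, M.accFrom_none.2 rfl⟩, ?_⟩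
          rintro q hq ⟨_ | t, ht', hw⟩
          · exact ht.2 q hq ht'
          · simp [NFA.accFrom_nil, N.accept_eq] at hw
        · rw [ih] at hw
          obtain ⟨hp', rfl⟩ := ht
          refine ⟨⟨some p', hp', hw.1⟩, ?_⟩
          rintro q hq ⟨_ | t, ht', hwt⟩
          · rw [N.accFrom_none] at hwt
            simp [hwt, NFA.accFrom_nil, M.accept_eq] at hw
          · exact hw.2 t ⟨q, hq, ht'⟩ hwt
      · rintro ⟨⟨_ | p', hp, hwp⟩, hS⟩
        · rw [M.accFrom_none] at hwp
          exact ⟨none, ⟨hp, fun q hq hn => hS q hq ⟨none, hn, N.accFrom_none.2 hwp⟩⟩,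
            (hU.accFrom_iff rfl).2 hwp⟩
        · refine ⟨some (p', _), ⟨hp, rfl⟩, (ih p' _).2 ⟨hwp, ?_⟩⟩
          rintro q' ⟨q, hq, hq'⟩ hw
          exact hS q hq ⟨some q', hq', hw⟩
  refine nsc_le_of_nfa U (some (M.init, {N.init})) (fun w => ?_) ?_
  · rw [key, M.accFrom_init]
    simp only [Set.mem_singleton_iff, forall_eq, N.accFrom_init]
    rfl
  · have h1 := M.card_le
    have h2 := N.card_le
    simp only [Fintype.card_option, Fintype.card_prod, Fintype.card_set]
    gcongr <;> omega

/-- In the automaton for the complement, the empty set of states accepts all nonempty words. -/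
theorem PrefixFreeNFA.nsc_compl_le {L : Language α} {n : ℕ} (N : L.PrefixFreeNFA n)
    (hL : L.PrefixFree) : (Lᶜ).nsc ≤ (2 ^ (n - 1) : ℕ) := by
  classical
  -- Completing a word of `L` leads to `∅`, which rejects the empty word. When no run continues, the
  -- word read so far must be accepted too, so a move to the accepting state `{N.init}` is added; it
  -- is harmless, as every continuation is then in the complement.
  let U : NFA α (Set N.Q) :=
    { step := fun S a => {T |
        ((∃ q ∈ S, none ∈ N.nfa.step (some q) a) ∧ T = ∅) ∨
        ((∀ q ∈ S, none ∉ N.nfa.step (some q) a) ∧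
          (T = {q' | ∃ q ∈ S, some q' ∈ N.nfa.step (some q) a} ∨
            ((∀ q ∈ S, N.nfa.step (some q) a = ∅) ∧ T = {N.init})))}
      start := {{N.init}}
      accept := {S | S.Nonempty} }
  have key : ∀ (w : List α) (S : Set N.Q),
      (∀ p ∈ S, ∀ q ∈ S, ∀ u v, N.nfa.AccFrom (some p) u → N.nfa.AccFrom (some q) (u ++ v) →
        v = []) →
      (U.AccFrom S w ↔ (S = ∅ → w ≠ []) ∧ ∀ q ∈ S, ¬ N.nfa.AccFrom (some q) w) := by
    intro w
    induction w with
    | nil =>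
      intro S _
      simp [NFA.accFrom_nil, U, N.accept_eq, Set.nonempty_iff_ne_empty]
    | cons a w ih =>
      intro S hS
      have hinit : U.AccFrom {N.init} [] := NFA.accFrom_nil.2 (Set.singleton_nonempty _)
      have hempty : U.AccFrom ∅ w ↔ w ≠ [] := by rw [ih ∅ (by simp)]; simp
      simp only [ne_eq, reduceCtorEq, not_false_eq_true, implies_true, true_and]
      rw [NFA.accFrom_cons]
      -- If some run ends here, prefix-freeness across all of `S` lets the other runs be forgotten.
      by_cases hf : ∃ q ∈ S, none ∈ N.nfa.step (some q) a
      · have hstep : ∀ T, T ∈ U.step S a ↔ T = ∅ := fun T => by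
          refine ⟨?_, fun h => Or.inl ⟨hf, h⟩⟩
          rintro (⟨_, h⟩ | ⟨h, _⟩)
          · exact h
          · obtain ⟨q, hq, hq'⟩ := hf
            exact absurd hq' (h q hq)
        simp only [hstep, exists_eq_left, hempty]
        obtain ⟨q, hq, hq'⟩ := hf
        have hqa : N.nfa.AccFrom (some q) [a] :=
          NFA.accFrom_cons.2 ⟨none, hq', N.accFrom_none.2 rfl⟩
        constructor
        · intro hw p hp hpw
          exact hw (hS q hq p hp [a] w hqa hpw)
        · rintro h rfl
          exact h q hq hqa
      · push Not at hf
        have hcons : ∀ q ∈ S, (N.nfa.AccFrom (some q) (a :: w) ↔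
            ∃ q', some q' ∈ N.nfa.step (some q) a ∧ N.nfa.AccFrom (some q') w) := fun q hq => by
          rw [NFA.accFrom_cons]
          constructor
          · rintro ⟨_ | t, ht, hw⟩
            · exact absurd ht (hf q hq)
            · exact ⟨t, ht, hw⟩
          · rintro ⟨t, ht, hw⟩
            exact ⟨some t, ht, hw⟩
        have hT := ih {q' | ∃ q ∈ S, some q' ∈ N.nfa.step (some q) a} (by
          rintro p ⟨p', hp', hp⟩ q ⟨q', hq', hq⟩ u v hu hv
          exact hS p' hp' q' hq' (a :: u) v (NFA.accFrom_cons.2 ⟨_, hp, hu⟩)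
            (NFA.accFrom_cons.2 ⟨_, hq, hv⟩))
        constructor
        · rintro ⟨T, ⟨⟨q, hq, hq'⟩, _⟩ | ⟨_, rfl | ⟨h, _⟩⟩, hw⟩ p hp hpw
          · exact hf q hq hq'
          · obtain ⟨p', hp', hw'⟩ := (hcons p hp).1 hpw
            exact (hT.1 hw).2 p' ⟨p, hp, hp'⟩ hw'
          · obtain ⟨p', hp', hw'⟩ := (hcons p hp).1 hpw
            simp [h p hp] at hp'
        · intro h
          -- Only in this case may the plain subset move fail: it may lead to `∅` with nothing left
          -- to read.
          by_cases hw : w = [] ∧ ∀ q ∈ S, N.nfa.step (some q) a = ∅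
          · exact ⟨{N.init}, Or.inr ⟨hf, Or.inr ⟨hw.2, rfl⟩⟩, hw.1 ▸ hinit⟩
          · refine ⟨_, Or.inr ⟨hf, Or.inl rfl⟩, hT.2 ⟨fun he hw' => hw ⟨hw', fun q hq => ?_⟩, ?_⟩⟩
            · rw [Set.eq_empty_iff_forall_notMem] at he ⊢
              rintro (_ | t) ht
              · exact hf q hq ht
              · exact he t ⟨q, hq, ht⟩
            · rintro q' ⟨q, hq, hq'⟩ hw'
              exact h q hq ((hcons q hq).2 ⟨q', hq', hw'⟩)
  refine nsc_le_of_nfa U {N.init} (fun w => ?_) ?_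
  · rw [key]
    · simp only [Set.singleton_ne_empty, false_imp_iff, true_and, Set.mem_singleton_iff, forall_eq,
        N.accFrom_init]
      rfl
    · simp only [Set.mem_singleton_iff, forall_eq, N.accFrom_init]
      intro u v hu hv
      by_contra hne
      exact hL.append_notMem hu hne hv
  · have h2 := N.card_le
    rw [Fintype.card_set]
    exact Nat.pow_le_pow_right (by norm_num) (by omega)

theorem PrefixFree.nsc_sup_le {K L : Language α} (hK : K.PrefixFree) (hL : L.PrefixFree) {m n : ℕ}
    (hm : 2 ≤ m) (hn : 2 ≤ n) (hKm : K.nsc = m) (hLn : L.nsc = n) :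
    (K ⊔ L).nsc ≤ (m + n : ℕ) :=
  (hK.nonempty_prefixFreeNFA hm hKm).elim fun M =>
    (hL.nonempty_prefixFreeNFA hn hLn).elim fun N => M.nsc_sup_le N

theorem PrefixFree.nsc_inf_le {K L : Language α} (hK : K.PrefixFree) (hL : L.PrefixFree) {m n : ℕ}
    (hm : 2 ≤ m) (hn : 2 ≤ n) (hKm : K.nsc = m) (hLn : L.nsc = n) :
    (K ⊓ L).nsc ≤ ((m - 1) * (n - 1) + 1 : ℕ) :=
  (hK.nonempty_prefixFreeNFA hm hKm).elim fun M =>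
    (hL.nonempty_prefixFreeNFA hn hLn).elim fun N => M.nsc_inf_le N

theorem PrefixFree.nsc_sdiff_le {K L : Language α} (hK : K.PrefixFree) (hL : L.PrefixFree) {m n : ℕ}
    (hm : 2 ≤ m) (hn : 2 ≤ n) (hKm : K.nsc = m) (hLn : L.nsc = n) :
    (K \ L).nsc ≤ ((m - 1) * 2 ^ (n - 1) + 1 : ℕ) :=
  (hK.nonempty_prefixFreeNFA hm hKm).elim fun M =>
    (hL.nonempty_prefixFreeNFA hn hLn).elim fun N => M.nsc_sdiff_le N

theorem PrefixFree.nsc_compl_le {L : Language α} (hL : L.PrefixFree) {n : ℕ} (hn : 2 ≤ n)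
    (hLn : L.nsc = n) : (Lᶜ).nsc ≤ (2 ^ (n - 1) : ℕ) :=
  (hL.nonempty_prefixFreeNFA hn hLn).elim fun N => N.nsc_compl_le hL

end Language

/-! ### Witness languages and lower bounds -/

namespace Language

variable {α : Type*}

theorem PrefixFree.of_terminated {L : Language α} (c : α)
    (h : ∀ w ∈ L, ∃ u, w = u ++ [c] ∧ c ∉ u) : L.PrefixFree := by
  intro x hx y hyx hne hy
  obtain ⟨u, rfl, hu⟩ := h x hx
  obtain ⟨v, rfl, -⟩ := h y hy
  rcases List.prefix_concat_iff.1 hyx with h | h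
  · exact hne h
  · exact hu (h.subset (by simp))

end Language

namespace NFA

variable {α : Type*} {σ : Type*}

/-- Determinism makes a word and its extension share a run, which cannot continue past a terminal
accepting state. -/
theorem prefixFree_accepts {M : NFA α σ} {s : σ} (hs : M.start = {s})
    (hdet : ∀ q a, (M.step q a).Subsingleton) (hM : M.AcceptTerminal) :
    M.accepts.PrefixFree := by
  have key : ∀ y z q, M.AccFrom q y → M.AccFrom q (y ++ z) → z = [] := by
    intro y z
    induction y with
    | nil =>
      intro q hy hz
      exact (hM.accFrom_iff (accFrom_nil.1 hy)).1 hz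
    | cons a y ih =>
      intro q hy hz
      obtain ⟨t, ht, hy⟩ := accFrom_cons.1 hy
      obtain ⟨t', ht', hz⟩ := accFrom_cons.1 hz
      rw [hdet q a ht' ht] at hz
      exact ih t hy hz
  rintro x hx y ⟨z, rfl⟩ hne hy
  rw [mem_accepts_iff_accFrom hs] at hx hy
  exact hne (by simp [key y z s hy hx])

/-! ### Words of the form `aᵗb` with `k ∣ t` -/

/-- The letter `a` rotates the states `ZMod k`, and `b` leads from `0` to acceptance. -/
def cycle (k : ℕ) (a b : α) : NFA α (Option (ZMod k)) where
  step o x := match o with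
    | none => ∅
    | some i => {t | (x = a ∧ t = some (i + 1)) ∨ (x = b ∧ i = 0 ∧ t = none)}
  start := {some 0}
  accept := {none}

section cycle

variable {k : ℕ} {a b : α}

theorem cycle_acceptTerminal : (cycle k a b).AcceptTerminal := by
  rintro q hq x
  rw [show q = none from hq]
  rfl

theorem cycle_cons_left (hab : a ≠ b) {i : ZMod k} {w : List α} :
    (cycle k a b).AccFrom (some i) (a :: w) ↔ (cycle k a b).AccFrom (some (i + 1)) w := by
  rw [accFrom_cons]
  simp [cycle, hab]

theorem cycle_cons_right (hab : a ≠ b) {i : ZMod k} {w : List α} :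
    (cycle k a b).AccFrom (some i) (b :: w) ↔ i = 0 ∧ w = [] := by
  rw [accFrom_cons, ← cycle_acceptTerminal.accFrom_iff (M := cycle k a b) (q := none) rfl]
  simp [cycle, hab.symm]

theorem cycle_nil {i : ZMod k} : ¬ (cycle k a b).AccFrom (some i) [] := by
  simp [accFrom_nil, cycle]

theorem cycle_replicate_append (hab : a ≠ b) {i : ZMod k} {t : ℕ} {w : List α} :
    (cycle k a b).AccFrom (some i) (List.replicate t a ++ w) ↔
      (cycle k a b).AccFrom (some (i + t)) w := by
  induction t generalizing i with
  | zero => simp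
  | succ t ih =>
    rw [List.replicate_succ, List.cons_append, cycle_cons_left hab, ih]
    push_cast
    rw [add_assoc, add_comm (1 : ZMod k)]

theorem cycle_replicate_append_singleton (hab : a ≠ b) {i : ZMod k} {t : ℕ} :
    (cycle k a b).AccFrom (some i) (List.replicate t a ++ [b]) ↔ i + t = 0 := by
  rw [cycle_replicate_append hab, cycle_cons_right hab]
  simp

theorem cycle_terminated (hab : a ≠ b) {i : ZMod k} {w : List α}
    (h : (cycle k a b).AccFrom (some i) w) : ∃ u, w = u ++ [b] ∧ b ∉ u := by
  induction w generalizing i with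
  | nil => exact absurd h cycle_nil
  | cons x w ih =>
    by_cases hx : x = a
    · subst hx
      obtain ⟨u, rfl, hu⟩ := ih ((cycle_cons_left hab).1 h)
      exact ⟨x :: u, rfl, by simp [hu, hab.symm]⟩
    · by_cases hb : x = b
      · subst hb
        exact ⟨[], by simp [((cycle_cons_right hab).1 h).2], by simp⟩
      · rw [accFrom_cons] at h
        simp [cycle, hx, hb] at h

theorem cycle_prefixFree (hab : a ≠ b) : (cycle k a b).accepts.PrefixFree :=
  .of_terminated b fun _ hw => cycle_terminated hab ((mem_accepts_iff_accFrom rfl).1 hw)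

theorem nsc_cycle [NeZero k] (hab : a ≠ b) :
    (cycle k a b).accepts.nsc = ((k + 1 : ℕ) : ℕ∞) := by
  refine le_antisymm (Language.nsc_le_of_nfa (cycle k a b) (some 0)
    (fun w => (mem_accepts_iff_accFrom rfl).symm) (by simp [ZMod.card])) ?_
  have h : ∀ i j : ZMod k, List.replicate i.val a ++ (List.replicate (-j).val a ++ [b]) ∈
      (cycle k a b).accepts ↔ i = j := fun i j => by
    rw [mem_accepts_iff_accFrom (s := some 0) rfl, cycle_replicate_append hab,
      cycle_replicate_append_singleton hab]
    simp [← sub_eq_add_neg, sub_eq_zero]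
  have := (cycle_prefixFree hab).card_succ_le_nsc (L := (cycle k a b).accepts)
    (fun i : ZMod k => List.replicate i.val a) (fun i => List.replicate (-i).val a ++ [b])
    (by simp) (fun i => (h i i).2 rfl) (fun i j hij _ => (h i j).1 hij)
  rwa [ZMod.card] at this

theorem le_nsc_cycle_sup_cycle {l : ℕ} [NeZero k] [NeZero l] (hab : a ≠ b) :
    ((k + l + 2 : ℕ) : ℕ∞) ≤ ((cycle k a b).accepts ⊔ (cycle l b a).accepts).nsc := by
  set U := (cycle k a b).accepts ⊔ (cycle l b a).accepts
  have hmem : ∀ w, w ∈ U ↔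
      (cycle k a b).AccFrom (some 0) w ∨ (cycle l b a).AccFrom (some 0) w := fun w =>
    or_congr (mem_accepts_iff_accFrom rfl) (mem_accepts_iff_accFrom rfl)
  have hnil : [] ∉ U := by simp [hmem, cycle_nil]
  have ha : ∀ t w, List.replicate (t + 1) a ++ w ∈ U ↔
      (cycle k a b).AccFrom (some ((t + 1 : ℕ) : ZMod k)) w ∨ t = 0 ∧ w = [] := fun t w => by
    rw [hmem, cycle_replicate_append hab, List.replicate_succ, List.cons_append,
      cycle_cons_right hab.symm]
    simp
  have hb : ∀ t w, List.replicate (t + 1) b ++ w ∈ U ↔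
      (cycle l b a).AccFrom (some ((t + 1 : ℕ) : ZMod l)) w ∨ t = 0 ∧ w = [] := fun t w => by
    rw [hmem, cycle_replicate_append hab.symm, List.replicate_succ, List.cons_append,
      cycle_cons_right hab, or_comm]
    simp
  have hka : ∀ (i : ZMod k) t, ¬ (cycle k a b).AccFrom (some i) (List.replicate t b ++ [a]) := by
    rintro i (_ | t)
    · simp [cycle_cons_left hab, cycle_nil]
    · simp [List.replicate_succ, cycle_cons_right hab]
  have hlb : ∀ (i : ZMod l) t, ¬ (cycle l b a).AccFrom (some i) (List.replicate t a ++ [b]) := by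
    rintro i (_ | t)
    · simp [cycle_cons_left hab.symm, cycle_nil]
    · simp [List.replicate_succ, cycle_cons_right hab.symm]
  have hfin : ∀ w, w ≠ [] → (List.replicate k a ++ [b]) ++ w ∉ U := fun w hw => by
    obtain ⟨t, ht⟩ := Nat.exists_eq_succ_of_ne_zero (NeZero.ne k)
    rw [List.append_assoc, ht, Nat.succ_eq_add_one, ha]
    simp [cycle_cons_right hab, hw]
  -- The exponents are `val + 1`, so at least one letter has been read: the other cycle has then
  -- either stopped or died. This gives `k + l + 1` pairs, and the initial state is an additional
  -- one.
  have := Language.card_succ_le_nsc_of_fooling (L := U) (ι := Option (ZMod k ⊕ ZMod l))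
    (fun o => o.elim (List.replicate k a ++ [b])
      (Sum.elim (fun i => List.replicate (i.val + 1) a) (fun j => List.replicate (j.val + 1) b)))
    (fun o => o.elim []
      (Sum.elim (fun i => List.replicate (-1 - i).val a ++ [b])
        (fun j => List.replicate (-1 - j).val b ++ [a]))) ?_ ?_ ?_
  · simpa [ZMod.card, add_assoc] using this
  · rintro (_ | i | j)
    · simp [hmem, cycle_replicate_append hab, cycle_cons_right hab]
    · simp only [Option.elim_some, Sum.elim_inl, ha, cycle_replicate_append_singleton hab]
      left
      simp
      ring
    · simp only [Option.elim_some, Sum.elim_inr, hb, cycle_replicate_append_singleton hab.symm]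
      left
      simp
      ring
  · rintro (_ | i | i) (_ | j | j) h1 h2
    · rfl
    · exact absurd h1 (hfin _ (by simp))
    · exact absurd h1 (hfin _ (by simp))
    · exact absurd h2 (hfin _ (by simp))
    · simp only [Option.elim_some, Sum.elim_inl, ha, cycle_replicate_append_singleton hab] at h1
      have h3 : i - j = 0 := by
        have h3 := by simpa using h1
        linear_combination h3
      rw [sub_eq_zero.1 h3]
    · simp [ha, hka] at h1
    · exact absurd h2 (hfin _ (by simp))
    · simp [hb, hlb] at h1
    · simp only [Option.elim_some, Sum.elim_inr, hb,
        cycle_replicate_append_singleton hab.symm] at h1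
      have h3 : i - j = 0 := by
        have h3 := by simpa using h1
        linear_combination h3
      rw [sub_eq_zero.1 h3]
  · rintro (_ | i | j) h
    · exact absurd h hnil
    · refine ⟨List.replicate l b ++ [a], ?_, ?_⟩
      · simp [hmem, cycle_replicate_append_singleton hab.symm]
      · simp [ha, hka]
    · refine ⟨List.replicate k a ++ [b], ?_, ?_⟩
      · simp [hmem, cycle_replicate_append_singleton hab]
      · simp [hb, hlb]

end cycle

/-! ### A rotating automaton with one exit -/

/-- The letter `a` rotates the states `ZMod k`, the letter `b` leads from `-1` to acceptance,
and in all other cases the state is kept. -/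
def gate (k : ℕ) (a b : α) : NFA α (Option (ZMod k)) where
  step o x := match o with
    | none => ∅
    | some i => {t | (x = a ∧ t = some (i + 1)) ∨ (x = b ∧ i = -1 ∧ t = none) ∨
        (x ≠ a ∧ ¬ (x = b ∧ i = -1) ∧ t = some i)}
  start := {some 0}
  accept := {none}

section gate

variable {k : ℕ} {a b : α}

theorem gate_acceptTerminal : (gate k a b).AcceptTerminal := by
  rintro q hq x
  rw [show q = none from hq]
  rfl

theorem gate_cons_rotate (hab : a ≠ b) {i : ZMod k} {w : List α} :
    (gate k a b).AccFrom (some i) (a :: w) ↔ (gate k a b).AccFrom (some (i + 1)) w := by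
  rw [accFrom_cons]
  simp [gate, hab]

theorem gate_cons_exit (hab : a ≠ b) {w : List α} :
    (gate k a b).AccFrom (some (-1)) (b :: w) ↔ w = [] := by
  rw [accFrom_cons, ← gate_acceptTerminal.accFrom_iff (M := gate k a b) (q := none) rfl]
  simp [gate, hab.symm]

theorem gate_cons_keep {x : α} (hx : x ≠ a) {i : ZMod k} (hi : i ≠ -1 ∨ x ≠ b) {w : List α} :
    (gate k a b).AccFrom (some i) (x :: w) ↔ (gate k a b).AccFrom (some i) w := by
  rw [accFrom_cons]
  rcases hi with hi | hi <;> simp [gate, hx, hi]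

theorem gate_nil {i : ZMod k} : ¬ (gate k a b).AccFrom (some i) [] := by
  simp [accFrom_nil, gate]

theorem gate_replicate_append (hab : a ≠ b) {i : ZMod k} {t : ℕ} {w : List α} :
    (gate k a b).AccFrom (some i) (List.replicate t a ++ w) ↔
      (gate k a b).AccFrom (some (i + t)) w := by
  induction t generalizing i with
  | zero => simp
  | succ t ih =>
    rw [List.replicate_succ, List.cons_append, gate_cons_rotate hab, ih]
    push_cast
    rw [add_assoc, add_comm (1 : ZMod k)]

theorem gate_append_of_keep {v : List α} (hv : a ∉ v) {i : ZMod k} (hi : i ≠ -1 ∨ b ∉ v)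
    {w : List α} :
    (gate k a b).AccFrom (some i) (v ++ w) ↔ (gate k a b).AccFrom (some i) w := by
  induction v with
  | nil => rfl
  | cons x v ih =>
    simp only [List.mem_cons, not_or] at hv hi
    rw [List.cons_append, gate_cons_keep (Ne.symm hv.1) (hi.imp_right fun h => Ne.symm h.1),
      ih hv.2 (hi.imp_right And.right)]

/-- Only `a` moves the state within the cycle, and the exit is at `-1`. The count modulo `k` thus
identifies the starting state in fooling arguments. -/
theorem add_count_eq_of_gate [DecidableEq α] (hab : a ≠ b) {i : ZMod k} {w : List α}
    (h : (gate k a b).AccFrom (some i) w) : i + (w.count a : ℕ) = -1 := by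
  induction w generalizing i with
  | nil => exact absurd h gate_nil
  | cons x w ih =>
    by_cases hx : x = a
    · subst hx
      have := ih ((gate_cons_rotate hab).1 h)
      simp only [List.count_cons_self, Nat.cast_add, Nat.cast_one]
      rw [← this]
      ring
    · rw [List.count_cons_of_ne hx]
      by_cases hi : i ≠ -1 ∨ x ≠ b
      · exact ih ((gate_cons_keep hx hi).1 h)
      · push Not at hi
        obtain ⟨rfl, rfl⟩ := hi
        rw [gate_cons_exit hab] at h
        simp [h]

theorem gate_singleton (hab : a ≠ b) {i : ZMod k} :
    (gate k a b).AccFrom (some i) [b] ↔ i = -1 := by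
  classical
  refine ⟨fun h => by simpa [hab.symm] using add_count_eq_of_gate hab h, ?_⟩
  rintro rfl
  rw [gate_cons_exit hab]

theorem gate_prefixFree (hab : a ≠ b) : (gate k a b).accepts.PrefixFree := by
  refine prefixFree_accepts (s := some 0) rfl ?_ gate_acceptTerminal
  rintro (_ | i) x s hs t ht
  · exact hs.elim
  · simp only [gate, Set.mem_ofPred_eq] at hs ht
    by_cases hx : x = a
    · subst hx
      simp_all
    · rcases hs with hs | hs | hs <;> rcases ht with ht | ht | ht <;> simp_all

theorem nsc_gate [NeZero k] (hab : a ≠ b) :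
    (gate k a b).accepts.nsc = ((k + 1 : ℕ) : ℕ∞) := by
  refine le_antisymm (Language.nsc_le_of_nfa (gate k a b) (some 0)
    (fun w => (mem_accepts_iff_accFrom rfl).symm) (by simp [ZMod.card])) ?_
  have h : ∀ i j : ZMod k, List.replicate i.val a ++ (List.replicate (-1 - j).val a ++ [b]) ∈
      (gate k a b).accepts ↔ i = j := fun i j => by
    rw [mem_accepts_iff_accFrom (s := some 0) rfl, gate_replicate_append hab,
      gate_replicate_append hab, gate_singleton hab]
    simp only [ZMod.natCast_val, ZMod.cast_id', id_eq, zero_add]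
    rw [← sub_eq_zero, ← sub_eq_zero (a := i)]
    ring_nf
  have := (gate_prefixFree hab).card_succ_le_nsc (L := (gate k a b).accepts)
    (fun i : ZMod k => List.replicate i.val a) (fun i => List.replicate (-1 - i).val a ++ [b])
    (by simp) (fun i => (h i i).2 rfl) (fun i j hij _ => (h i j).1 hij)
  rwa [ZMod.card] at this

end gate

/-! ### Words with exactly `l` letters `b`, the last letter being one of them -/

/-- The automaton counts the letters `b` up to `l`. -/
def counter (l : ℕ) (b : α) : NFA α (Fin (l + 1)) where
  step j x := {t | (x = b ∧ t.val = j.val + 1) ∨ (x ≠ b ∧ t = j ∧ j.val ≠ l)}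
  start := {0}
  accept := {Fin.last l}

section counter

variable {l : ℕ} {b : α}

theorem counter_prefixFree : (counter l b).accepts.PrefixFree := by
  refine prefixFree_accepts (s := 0) rfl ?_ ?_
  · rintro j x s (⟨h1, h2⟩ | ⟨h1, h2, h3⟩) t (⟨h4, h5⟩ | ⟨h4, h5, h6⟩)
    · exact Fin.ext (h2.trans h5.symm)
    · exact absurd h1 h4
    · exact absurd h4 h1
    · exact h2.trans h5.symm
  · rintro q hq x
    rw [show q = Fin.last l from hq, Set.eq_empty_iff_forall_notMem]
    rintro t (⟨-, h⟩ | ⟨-, -, h⟩)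
    · have := t.2
      simp only [Fin.val_last] at h
      omega
    · exact h rfl

variable [DecidableEq α]

theorem add_count_eq_of_counter {j : Fin (l + 1)} {w : List α}
    (h : (counter l b).AccFrom j w) : j.val + w.count b = l := by
  induction w generalizing j with
  | nil =>
    have : j = Fin.last l := accFrom_nil.1 h
    simp [this]
  | cons x w ih =>
    obtain ⟨t, ⟨rfl, ht⟩ | ⟨hx, rfl, -⟩, hw⟩ := accFrom_cons.1 h
    · have := ih hw
      rw [List.count_cons_self]
      omega
    · rw [List.count_cons_of_ne hx]
      exact ih hw

theorem counter_append_singleton {j : Fin (l + 1)} {w : List α}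
    (h : j.val + w.count b + 1 = l) : (counter l b).AccFrom j (w ++ [b]) := by
  induction w generalizing j with
  | nil =>
    refine accFrom_cons.2 ⟨Fin.last l, Or.inl ⟨rfl, ?_⟩, accFrom_nil.2 rfl⟩
    simpa using h.symm
  | cons x w ih =>
    by_cases hx : x = b
    · subst hx
      rw [List.count_cons_self] at h
      exact accFrom_cons.2 ⟨⟨j + 1, by omega⟩, Or.inl ⟨rfl, rfl⟩, ih (by simp only; omega)⟩
    · rw [List.count_cons_of_ne hx] at h
      exact accFrom_cons.2 ⟨j, Or.inr ⟨hx, rfl, by omega⟩, ih h⟩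

theorem nsc_counter [NeZero l] : (counter l b).accepts.nsc = ((l + 1 : ℕ) : ℕ∞) := by
  refine le_antisymm (Language.nsc_le_of_nfa (counter l b) 0
    (fun w => (mem_accepts_iff_accFrom rfl).symm) (by simp)) ?_
  have := (counter_prefixFree (l := l) (b := b)).card_succ_le_nsc
    (fun i : Fin l => List.replicate i.val b) (fun i => List.replicate (l - 1 - i) b ++ [b])
    (by simp) (fun i => ?_) (fun i j hij _ => ?_)
  · rwa [Fintype.card_fin] at this
  · rw [mem_accepts_iff_accFrom (s := 0) rfl, ← List.append_assoc]
    refine counter_append_singleton ?_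
    simp
    omega
  · rw [mem_accepts_iff_accFrom (s := 0) rfl] at hij
    have := add_count_eq_of_counter hij
    simp at this
    exact Fin.ext (by omega)

end counter

theorem le_nsc_gate_inf_counter {k l : ℕ} {a b : α} (hk : 2 ≤ k) [NeZero l] (hab : a ≠ b) :
    ((k * l + 1 : ℕ) : ℕ∞) ≤ ((gate k a b).accepts ⊓ (counter l b).accepts).nsc := by
  classical
  have : NeZero k := ⟨by omega⟩
  have : Fact (1 < k) := ⟨hk⟩
  set U := (gate k a b).accepts ⊓ (counter l b).accepts
  have hmem : ∀ w, w ∈ U ↔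
      (gate k a b).AccFrom (some 0) w ∧ (counter l b).AccFrom 0 w := fun w =>
    and_congr (mem_accepts_iff_accFrom rfl) (mem_accepts_iff_accFrom rfl)
  have hpf : U.PrefixFree := (gate_prefixFree hab).mono fun w hw => hw.1
  let x : ZMod k × Fin l → List α := fun p => List.replicate p.2 b ++ List.replicate p.1.val a
  -- At `-1` a letter `b` would exit too early; one `a` first moves to `0`, and `k - 1` further ones
  -- return to `-1` after the letters `b` are read.
  let y' : ZMod k × Fin l → List α := fun p =>
    if p.1 = -1 then a :: List.replicate (l - 1 - p.2) b ++ List.replicate (k - 1) a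
    else List.replicate (l - 1 - p.2) b ++ List.replicate (-1 - p.1).val a
  have h01 : (0 : ZMod k) ≠ -1 := by simp
  have hx : ∀ p w, (gate k a b).AccFrom (some 0) (x p ++ w) ↔
      (gate k a b).AccFrom (some p.1) w := fun p w => by
    rw [List.append_assoc, gate_append_of_keep (by simp [List.mem_replicate, hab]) (Or.inl h01),
      gate_replicate_append hab]
    simp
  have hya : ∀ p, (((y' p ++ [b]).count a : ℕ) : ZMod k) = -1 - p.1 := fun p => by
    simp only [y']
    split_ifs with h
    · simp [List.count_replicate, hab.symm, h]
      rw [Nat.cast_sub (by omega)]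
      simp
    · simp [List.count_replicate, hab.symm]
  have hyb : ∀ p, (y' p).count b = l - 1 - p.2 := fun p => by
    simp only [y']
    split_ifs with h <;> simp [List.count_replicate, hab]
  have := hpf.card_succ_le_nsc x (fun p => y' p ++ [b]) (by simp) ?_ ?_
  · simpa [ZMod.card] using this
  · intro p
    rw [hmem, hx]
    constructor
    · simp only [y']
      split_ifs with h
      · rw [h, List.append_assoc, List.cons_append, gate_cons_rotate hab, neg_add_cancel,
          gate_append_of_keep (by simp [List.mem_replicate, hab]) (Or.inl h01),
          gate_replicate_append hab, gate_singleton hab, Nat.cast_sub (by omega)]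
        simp
      · rw [List.append_assoc,
          gate_append_of_keep (by simp [List.mem_replicate, hab]) (Or.inl h),
          gate_replicate_append hab, gate_singleton hab]
        simp
    · rw [← List.append_assoc]
      refine counter_append_singleton ?_
      rw [List.count_append, hyb]
      simp [x, List.count_replicate, hab]
      omega
  · intro p q hpq _
    rw [hmem, hx] at hpq
    have h1 := add_count_eq_of_gate hab hpq.1
    rw [hya] at h1
    have h2 := add_count_eq_of_counter hpq.2
    rw [List.count_append, List.count_append, List.count_append, hyb] at h2
    simp [List.count_replicate, hab] at h2
    refine Prod.ext (sub_eq_zero.1 ?_) (Fin.ext (by omega))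
    linear_combination h1

end NFA

/-! ### Generating all nonempty subsets of `ZMod k` -/

namespace ZMod

variable {k : ℕ}

/-- The symmetric relation on `ZMod k` with pairs `(0, 1)`, `(1, 0)`, `(1, 1)` and `(i, i)`
for `i ≠ 0, 1`. -/
def MergeRel (i j : ZMod k) : Prop :=
  (i = 0 ∧ j = 1) ∨ (i = 1 ∧ (j = 0 ∨ j = 1)) ∨ (i ≠ 0 ∧ i ≠ 1 ∧ j = i)

/-- Symmetry makes images and preimages under the relation agree, so one induction serves both
reachability and co-reachability. -/
theorem MergeRel.symm {i j : ZMod k} (h : MergeRel i j) : MergeRel j i := by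
  unfold MergeRel at *
  rcases h with ⟨rfl, rfl⟩ | ⟨rfl, rfl | rfl⟩ | ⟨h0, h1, rfl⟩ <;> simp_all

theorem mergeRel_comm {i j : ZMod k} : MergeRel i j ↔ MergeRel j i :=
  ⟨.symm, .symm⟩

theorem mergeRel_sub_iff {c i j : ZMod k} : MergeRel (i - c) (j - c) ↔
    (i = c ∧ j = c + 1) ∨ (i = c + 1 ∧ (j = c ∨ j = c + 1)) ∨ (i ≠ c ∧ i ≠ c + 1 ∧ j = i) := by
  simp only [MergeRel, ne_eq, sub_eq_iff_eq_add, zero_add, add_comm (1 : ZMod k), sub_add_cancel]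

/-- Every nonempty set of states arises from `{0}` by rotations and images under `MergeRel`. -/
theorem merge_induction (hk : 2 ≤ k) {P : Set (ZMod k) → Prop} (zero : P {0})
    (shift : ∀ (c : ZMod k) S, P S → P {j | j + c ∈ S})
    (merge : ∀ S, P S → P {j | ∃ i ∈ S, MergeRel i j}) {S : Set (ZMod k)} (hS : S.Nonempty) :
    P S := by
  have : Fact (1 < k) := ⟨hk⟩
  have : NeZero k := ⟨by omega⟩
  -- Conjugating by a rotation lets the merge act at `c, c + 1` in place of `0, 1`.
  have mergeAt : ∀ (c : ZMod k) S, P S → P {j | ∃ i ∈ S, MergeRel (i - c) (j - c)} := by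
    intro c S h
    refine (congrArg P ?_).mp (shift (-c) _ (merge _ (shift c S h)))
    ext j
    simp only [Set.mem_ofPred_eq, sub_eq_add_neg]
    constructor
    · rintro ⟨i, hi, hr⟩
      exact ⟨i + c, hi, by simpa using hr⟩
    · rintro ⟨i, hi, hr⟩
      exact ⟨i + -c, by simpa using hi, hr⟩
  have key : ∀ (r : ℕ) (T : Finset (ZMod k)), T.card = r + 1 → P T := by
    intro r
    induction r with
    | zero =>
      intro T hT
      obtain ⟨i, rfl⟩ := Finset.card_eq_one.1 hT
      refine (congrArg P ?_).mp (shift (-i) _ zero)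
      ext j
      simp [← sub_eq_add_neg, sub_eq_zero]
    | succ r ihr =>
      -- Delete `j`: merging at `j` sends `j + 1` to both `j` and `j + 1`, which restores it.
      have adjacent : ∀ (T : Finset (ZMod k)) (j : ZMod k), T.card = r + 1 + 1 → j ∈ T →
          j + 1 ∈ T → P T := by
        intro T j hT hj hj1
        refine (congrArg P ?_).mp (mergeAt j _ (ihr (T.erase j) (by
          rw [Finset.card_erase_of_mem hj]; omega)))
        ext x
        simp only [Finset.mem_coe, Finset.mem_erase, Set.mem_ofPred_eq, mergeRel_sub_iff]
        constructor
        · rintro ⟨i, ⟨hne, hi⟩, ⟨h, -⟩ | ⟨-, rfl | h⟩ | ⟨-, -, h⟩⟩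
          · exact absurd h hne
          · exact hj
          · rwa [h]
          · rwa [h]
        · intro hx
          by_cases hx0 : x = j
          · exact ⟨j + 1, ⟨by simp, hj1⟩, Or.inr (Or.inl ⟨rfl, Or.inl hx0⟩)⟩
          · by_cases hx1 : x = j + 1
            · exact ⟨j + 1, ⟨by simp, hj1⟩, Or.inr (Or.inl ⟨rfl, Or.inr hx1⟩)⟩
            · exact ⟨x, ⟨hx0, hx⟩, Or.inr (Or.inr ⟨hx0, hx1, rfl⟩)⟩
      -- Induction on the distance between two elements: if `j = i + d` is not in `T`, then `T` is
      -- the merge at `j` of the set with `j + 1` replaced by `j`.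
      have gap : ∀ (d : ℕ) (T : Finset (ZMod k)) (i : ZMod k), T.card = r + 1 + 1 → i ∈ T →
          i + d ∈ T → i + d ≠ i → P T := by
        intro d
        induction d with
        | zero =>
          intro T i _ _ _ hne
          simp at hne
        | succ d ihd =>
          intro T i hT hi hid hne
          push_cast at hid hne
          rw [← add_assoc] at hid hne
          obtain ⟨j, hj⟩ : ∃ j, j = i + (d : ZMod k) := ⟨_, rfl⟩
          rw [← hj] at hid hne
          by_cases hjT : j ∈ T
          · exact adjacent T j hT hjT hid
          · have hij : i ≠ j := fun h => hjT (h ▸ hi)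
            refine (congrArg P ?_).mp (mergeAt j _ (ihd (insert j (T.erase (j + 1))) i ?_ ?_ ?_ ?_))
            · ext x
              simp only [Finset.mem_coe, Finset.mem_insert, Finset.mem_erase, Set.mem_ofPred_eq,
                mergeRel_sub_iff]
              constructor
              · rintro ⟨i, hi | ⟨hne, hi⟩, ⟨h, h'⟩ | ⟨h', -⟩ | ⟨h', -, h⟩⟩
                · rwa [h']
                · exact absurd (h'.symm.trans hi) (by simp)
                · exact absurd hi h'
                · rwa [h']
                · exact absurd h' hne
                · rwa [h]
              · intro hx
                by_cases hx1 : x = j + 1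
                · exact ⟨j, Or.inl rfl, Or.inl ⟨rfl, hx1⟩⟩
                · have hx0 : x ≠ j := fun h => hjT (h ▸ hx)
                  exact ⟨x, Or.inr ⟨hx1, hx⟩, Or.inr (Or.inr ⟨hx0, hx1, rfl⟩)⟩
            · rw [Finset.card_insert_of_notMem (by simp [hjT]), Finset.card_erase_of_mem hid]
              omega
            · exact Finset.mem_insert_of_mem (Finset.mem_erase.2 ⟨hne.symm, hi⟩)
            · rw [← hj]
              exact Finset.mem_insert_self _ _
            · rw [← hj]
              exact hij.symm
      intro T hT
      obtain ⟨i, hi, j, hj, hij⟩ := Finset.one_lt_card.1 (by omega : 1 < T.card)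
      have hj' : i + ((j - i).val : ZMod k) = j := by simp
      exact gap (j - i).val T i hT hi (by rwa [hj']) (by rw [hj']; exact hij.symm)
  classical
  have hcard : 0 < S.toFinset.card := Finset.card_pos.2 (Set.toFinset_nonempty.2 hS)
  simpa using key (S.toFinset.card - 1) S.toFinset (by omega)

end ZMod

namespace NFA

variable {α : Type*}

/-! ### An automaton all of whose sets of states are reachable and co-reachable -/

/-- The letter `a` rotates the states `ZMod k`, the letter `b` acts by `ZMod.MergeRel`, the
letter `c` leads from `0` to acceptance, and all other letters keep the state. -/
def merger (k : ℕ) (a b c : α) : NFA α (Option (ZMod k)) where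
  step o x := match o with
    | none => ∅
    | some i => {t | (x = a ∧ t = some (i + 1)) ∨ (x = b ∧ ∃ j, ZMod.MergeRel i j ∧ t = some j) ∨
        (x = c ∧ i = 0 ∧ t = none) ∨ (x ≠ a ∧ x ≠ b ∧ x ≠ c ∧ t = some i)}
  start := {some 0}
  accept := {none}

section merger

variable {k : ℕ} {a b c : α}

theorem merger_acceptTerminal : (merger k a b c).AcceptTerminal := by
  rintro q hq x
  rw [show q = none from hq]
  rfl

theorem merger_cons_rotate (hab : a ≠ b) (hac : a ≠ c) {i : ZMod k} {w : List α} :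
    (merger k a b c).AccFrom (some i) (a :: w) ↔ (merger k a b c).AccFrom (some (i + 1)) w := by
  rw [accFrom_cons]
  simp [merger, hab, hac]

theorem merger_cons_merge (hab : a ≠ b) (hbc : b ≠ c) {i : ZMod k} {w : List α} :
    (merger k a b c).AccFrom (some i) (b :: w) ↔
      ∃ j, ZMod.MergeRel i j ∧ (merger k a b c).AccFrom (some j) w := by
  rw [accFrom_cons]
  simp [merger, hab.symm, hbc]

theorem merger_cons_exit (hac : a ≠ c) (hbc : b ≠ c) {i : ZMod k} {w : List α} :
    (merger k a b c).AccFrom (some i) (c :: w) ↔ i = 0 ∧ w = [] := by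
  rw [accFrom_cons, ← merger_acceptTerminal.accFrom_iff (M := merger k a b c) (q := none) rfl]
  simp [merger, hac.symm, hbc.symm]

theorem merger_nil {i : ZMod k} : ¬ (merger k a b c).AccFrom (some i) [] := by
  simp [accFrom_nil, merger]

theorem merger_replicate_keep {d : α} (hda : d ≠ a) (hdb : d ≠ b) (hdc : d ≠ c) {i : ZMod k}
    {t : ℕ} {w : List α} :
    (merger k a b c).AccFrom (some i) (List.replicate t d ++ w) ↔
      (merger k a b c).AccFrom (some i) w := by
  induction t with
  | zero => rfl
  | succ t ih =>
    rw [List.replicate_succ, List.cons_append, accFrom_cons]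
    simp [merger, hda, hdb, hdc] at ih ⊢
    exact ih

theorem merger_replicate_append (hab : a ≠ b) (hac : a ≠ c) {i : ZMod k} {t : ℕ} {w : List α} :
    (merger k a b c).AccFrom (some i) (List.replicate t a ++ w) ↔
      (merger k a b c).AccFrom (some (i + t)) w := by
  induction t generalizing i with
  | zero => simp
  | succ t ih =>
    rw [List.replicate_succ, List.cons_append, merger_cons_rotate hab hac, ih]
    push_cast
    rw [add_assoc, add_comm (1 : ZMod k)]

theorem merger_terminated (hac : a ≠ c) (hbc : b ≠ c) {i : ZMod k} {w : List α}
    (h : (merger k a b c).AccFrom (some i) w) : ∃ u, w = u ++ [c] ∧ c ∉ u := by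
  induction w generalizing i with
  | nil => exact absurd h merger_nil
  | cons x w ih =>
    by_cases hx : x = c
    · subst hx
      exact ⟨[], by simp [((merger_cons_exit hac hbc).1 h).2], by simp⟩
    · obtain ⟨_ | t, ht, h⟩ := accFrom_cons.1 h
      · simp [merger, hx] at ht
      · obtain ⟨u, rfl, hu⟩ := ih h
        exact ⟨x :: u, rfl, by simp [hu, Ne.symm hx]⟩

theorem merger_prefixFree (hac : a ≠ c) (hbc : b ≠ c) : (merger k a b c).accepts.PrefixFree :=
  .of_terminated c fun _ hw => merger_terminated hac hbc ((mem_accepts_iff_accFrom rfl).1 hw)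

theorem nsc_merger [NeZero k] (hab : a ≠ b) (hac : a ≠ c) (hbc : b ≠ c) :
    (merger k a b c).accepts.nsc = ((k + 1 : ℕ) : ℕ∞) := by
  refine le_antisymm (Language.nsc_le_of_nfa (merger k a b c) (some 0)
    (fun w => (mem_accepts_iff_accFrom rfl).symm) (by simp [ZMod.card])) ?_
  have h : ∀ i j : ZMod k, List.replicate i.val a ++ (List.replicate (-j).val a ++ [c]) ∈
      (merger k a b c).accepts ↔ i = j := fun i j => by
    rw [mem_accepts_iff_accFrom (s := some 0) rfl, merger_replicate_append hab hac,
      merger_replicate_append hab hac, merger_cons_exit hac hbc]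
    simp [← sub_eq_add_neg, sub_eq_zero]
  have := (merger_prefixFree hac hbc).card_succ_le_nsc (L := (merger k a b c).accepts)
    (fun i : ZMod k => List.replicate i.val a) (fun i => List.replicate (-i).val a ++ [c])
    (by simp) (fun i => (h i i).2 rfl) (fun i j hij _ => (h i j).1 hij)
  rwa [ZMod.card] at this

theorem exists_reaching_word (hk : 2 ≤ k) (hab : a ≠ b) (hac : a ≠ c) (hbc : b ≠ c)
    (S : Set (ZMod k)) : ∃ x : List α, (∀ e ∈ x, e = a ∨ e = b ∨ e = c) ∧
      ∀ z, (merger k a b c).AccFrom (some 0) (x ++ z) ↔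
        ∃ i ∈ S, (merger k a b c).AccFrom (some i) z := by
  have : NeZero k := ⟨by omega⟩
  rcases S.eq_empty_or_nonempty with rfl | hS
  -- The first `c` either ends the run or kills it, so nothing survives the second.
  · exact ⟨[c, c], by simp, by simp [merger_cons_exit hac hbc]⟩
  · refine ZMod.merge_induction (P := fun S => ∃ x : List α, (∀ e ∈ x, e = a ∨ e = b ∨ e = c) ∧
      ∀ z, (merger k a b c).AccFrom (some 0) (x ++ z) ↔
        ∃ i ∈ S, (merger k a b c).AccFrom (some i) z) hk ⟨[], by simp, by simp⟩ ?_ ?_ hS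
    · rintro d T ⟨x, hx, h⟩
      refine ⟨x ++ List.replicate (-d).val a, ?_, fun z => ?_⟩
      · simp only [List.mem_append, List.mem_replicate]
        rintro e (he | he)
        · exact hx e he
        · exact Or.inl he.2
      · simp only [List.append_assoc, h, merger_replicate_append hab hac]
        constructor
        · rintro ⟨i, hi, hz⟩
          exact ⟨i + -d, by simpa using hi, by simpa using hz⟩
        · rintro ⟨i, hi, hz⟩
          exact ⟨i + d, hi, by simpa using hz⟩
    · rintro T ⟨x, hx, h⟩
      refine ⟨x ++ [b], ?_, fun z => ?_⟩
      · simp only [List.mem_append, List.mem_singleton]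
        rintro e (he | he)
        · exact hx e he
        · exact Or.inr (Or.inl he)
      · simp only [List.append_assoc, h, List.cons_append, List.nil_append,
          merger_cons_merge hab hbc]
        constructor
        · rintro ⟨i, hi, j, hij, hz⟩
          exact ⟨j, ⟨i, hi, hij⟩, hz⟩
        · rintro ⟨j, ⟨i, hi, hij⟩, hz⟩
          exact ⟨i, hi, j, hij, hz⟩

theorem exists_coreaching_word (hk : 2 ≤ k) (hab : a ≠ b) (hac : a ≠ c) (hbc : b ≠ c)
    {S : Set (ZMod k)} (hS : S.Nonempty) : ∃ y : List α, (∀ e ∈ y, e = a ∨ e = b) ∧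
      ∀ z, (∀ i : ZMod k, (merger k a b c).AccFrom (some i) z ↔ i = 0) →
        ∀ i, (merger k a b c).AccFrom (some i) (y ++ z) ↔ i ∈ S := by
  have : NeZero k := ⟨by omega⟩
  refine ZMod.merge_induction (P := fun S => ∃ y : List α, (∀ e ∈ y, e = a ∨ e = b) ∧
      ∀ z, (∀ i : ZMod k, (merger k a b c).AccFrom (some i) z ↔ i = 0) →
        ∀ i, (merger k a b c).AccFrom (some i) (y ++ z) ↔ i ∈ S) hk ⟨[], by simp, by simp⟩ ?_ ?_ hS
  · rintro d T ⟨y, hy, h⟩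
    refine ⟨List.replicate d.val a ++ y, ?_, fun z hz i => ?_⟩
    · simp only [List.mem_append, List.mem_replicate]
      rintro e (he | he)
      · exact Or.inl he.2
      · exact hy e he
    · rw [List.append_assoc, merger_replicate_append hab hac, h z hz]
      simp
  · rintro T ⟨y, hy, h⟩
    refine ⟨b :: y, ?_, fun z hz i => ?_⟩
    · simp only [List.mem_cons]
      rintro e (he | he)
      · exact Or.inr he
      · exact hy e he
    · simp only [List.cons_append, merger_cons_merge hab hbc, h z hz, Set.mem_ofPred_eq]
      exact exists_congr fun j => by rw [and_comm, ZMod.mergeRel_comm]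

/-- Let `x S` reach exactly `S` and let `y T` be accepted exactly off `T`: then `x S ++ y T` avoids
the language iff `S ⊆ T`, and antisymmetry of inclusion gives a fooling set indexed by all subsets.
-/
theorem le_nsc_compl_merger (hk : 2 ≤ k) (hab : a ≠ b) (hac : a ≠ c) (hbc : b ≠ c) :
    ((2 ^ k : ℕ) : ℕ∞) ≤ ((merger k a b c).accepts)ᶜ.nsc := by
  classical
  have : NeZero k := ⟨by omega⟩
  choose x _ hx using exists_reaching_word (a := a) (b := b) (c := c) hk hab hac hbc
  have hy : ∀ S : Set (ZMod k), ∃ y : List α,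
      ∀ i, (merger k a b c).AccFrom (some i) y ↔ i ∉ S := fun S => by
    rcases Sᶜ.eq_empty_or_nonempty with hS | hS
    · refine ⟨[], fun i => ?_⟩
      simp [merger_nil, Set.compl_empty_iff.1 hS]
    · obtain ⟨y, -, hy⟩ := exists_coreaching_word (a := a) (b := b) (c := c) hk hab hac hbc hS
      exact ⟨y ++ [c], hy [c] fun i => by simp [merger_cons_exit hac hbc]⟩
  choose y hy using hy
  have h : ∀ S T, x S ++ y T ∈ ((merger k a b c).accepts)ᶜ ↔ S ⊆ T := fun S T => by
    have h1 : x S ++ y T ∈ ((merger k a b c).accepts)ᶜ ↔ x S ++ y T ∉ (merger k a b c).accepts :=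
      Iff.rfl
    rw [h1, mem_accepts_iff_accFrom (s := some 0) rfl, hx]
    simp only [hy, not_exists, not_and, not_not]
    rfl
  have := Language.card_le_nsc_of_fooling (L := ((merger k a b c).accepts)ᶜ) x y
    (fun S => (h S S).2 subset_rfl)
    (fun S T h1 h2 => ((h S T).1 h1).antisymm ((h T S).1 h2))
  rwa [Fintype.card_set, ZMod.card] at this

end merger

/-- The letters `a, b` do not move the gate and `d` does not move the merger, so both components are
steered independently; only the exit letter `c` is shared. -/
theorem le_nsc_gate_sdiff_merger {k l : ℕ} {a b c d : α} (hk : 2 ≤ k) (hl : 2 ≤ l) (hab : a ≠ b)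
    (hac : a ≠ c) (hbc : b ≠ c) (hda : d ≠ a) (hdb : d ≠ b) (hdc : d ≠ c) :
    ((k * 2 ^ l + 1 : ℕ) : ℕ∞) ≤ ((gate k d c).accepts \ (merger l a b c).accepts).nsc := by
  classical
  have : NeZero k := ⟨by omega⟩
  have : NeZero l := ⟨by omega⟩
  have : Fact (1 < k) := ⟨hk⟩
  set U := (gate k d c).accepts \ (merger l a b c).accepts
  have hmem : ∀ w, w ∈ U ↔
      (gate k d c).AccFrom (some 0) w ∧ ¬ (merger l a b c).AccFrom (some 0) w := fun w =>
    and_congr (mem_accepts_iff_accFrom rfl) (not_congr (mem_accepts_iff_accFrom rfl))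
  have hpf : U.PrefixFree := (gate_prefixFree hdc).mono fun w hw => hw.1
  have h01 : (0 : ZMod k) ≠ -1 := by simp
  choose x hx' hx using exists_reaching_word (a := a) (b := b) (c := c) hl hab hac hbc
  have hy : ∀ (p : ZMod k) (S : Set (ZMod l)), ∃ y : List α,
      ((y.count d : ℕ) : ZMod k) = -1 - p ∧ (gate k d c).AccFrom (some p) y ∧
      ∀ i, (merger l a b c).AccFrom (some i) y ↔ i ∉ S := by
    intro p S
    rcases Sᶜ.eq_empty_or_nonempty with hS | hS
    · rw [Set.compl_empty_iff] at hS
      by_cases hp : p = -1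
      -- An early `c` followed by more letters kills every merger run. The gate ignores it off `-1`,
      -- so from `-1` it is first rotated to `0`.
      · refine ⟨d :: c :: (List.replicate (k - 1) d ++ [c]), ?_, ?_, fun i => ?_⟩
        · simp [hdc.symm, hp]
          rw [Nat.cast_sub (by omega)]
          simp
        · rw [hp, gate_cons_rotate hdc, neg_add_cancel, gate_cons_keep hdc.symm (Or.inl h01),
            gate_replicate_append hdc, gate_singleton hdc, Nat.cast_sub (by omega)]
          simp
        · have := merger_replicate_keep (k := l) (t := 1) (i := i) hda hdb hdc
            (w := c :: (List.replicate (k - 1) d ++ [c]))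
          simp only [List.replicate_one, List.cons_append, List.nil_append] at this
          rw [this, merger_cons_exit hac hbc]
          simp [hS]
      · refine ⟨c :: (List.replicate (-1 - p).val d ++ [c]), ?_, ?_, fun i => ?_⟩
        · simp [hdc.symm]
        · rw [gate_cons_keep hdc.symm (Or.inl hp), gate_replicate_append hdc, gate_singleton hdc]
          simp
        · rw [merger_cons_exit hac hbc]
          simp [hS]
    · obtain ⟨y, hyab, hy⟩ := exists_coreaching_word (a := a) (b := b) (c := c) hl hab hac hbc hS
      have hdy : d ∉ y := fun h => (hyab d h).elim hda hdb
      have hcy : c ∉ y := fun h => (hyab c h).elim hac.symm hbc.symm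
      refine ⟨y ++ (List.replicate (-1 - p).val d ++ [c]), ?_, ?_, hy _ fun i => ?_⟩
      · simp [hdc.symm, List.count_eq_zero_of_not_mem hdy]
      · rw [gate_append_of_keep hdy (Or.inr hcy), gate_replicate_append hdc, gate_singleton hdc]
        simp
      · rw [merger_replicate_keep hda hdb hdc, merger_cons_exit hac hbc]
        simp
  choose y hyd hyk hyl using hy
  -- `x S` may contain `c`, but it is read by the gate in state `0 ≠ -1`, where `c` has no effect.
  have hK : ∀ (p : ZMod k) S z, (gate k d c).AccFrom (some 0)
      ((x S ++ List.replicate p.val d) ++ z) ↔ (gate k d c).AccFrom (some p) z := fun p S z => by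
    rw [List.append_assoc, gate_append_of_keep ?_ (Or.inl h01), gate_replicate_append hdc]
    · simp
    · intro h
      rcases hx' S d h with h | h | h
      exacts [hda h, hdb h, hdc h]
  have hL : ∀ (p q : ZMod k) S T, (merger l a b c).AccFrom (some 0)
      ((x S ++ List.replicate p.val d) ++ y q T) ↔ ¬ S ⊆ T := fun p q S T => by
    rw [List.append_assoc, hx, Set.not_subset]
    simp only [merger_replicate_keep hda hdb hdc, hyl]
  have := hpf.card_succ_le_nsc
    (fun p : ZMod k × Set (ZMod l) => x p.2 ++ List.replicate p.1.val d) (fun p => y p.1 p.2)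
    ?_ ?_ ?_
  · simpa [ZMod.card] using this
  · intro p h
    have := hyk p.1 p.2
    rw [h] at this
    exact gate_nil this
  · intro p
    rw [hmem, hK, hL]
    exact ⟨hyk _ _, not_not.2 subset_rfl⟩
  · intro p q h1 h2
    rw [hmem, hK, hL, not_not] at h1 h2
    refine Prod.ext (sub_eq_zero.1 ?_) (h1.2.antisymm h2.2)
    have h3 := add_count_eq_of_gate hdc h1.1
    rw [hyd] at h3
    linear_combination h3

end NFA

/-! ### Assembling the four operations -/

theorem theorem8 (m n : ℕ) (hm : 3 ≤ m) (hn : 3 ≤ n) :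
    -- union
    ((∀ (α : Type*) (K L : Language α), K.PrefixFree → L.PrefixFree →
          K.nsc = (m : ℕ∞) → L.nsc = (n : ℕ∞) →
          (K ⊔ L).nsc ≤ ((m + n : ℕ) : ℕ∞)) ∧
      (∃ K L : Language (Fin 2), K.PrefixFree ∧ L.PrefixFree ∧
          K.nsc = (m : ℕ∞) ∧ L.nsc = (n : ℕ∞) ∧
          (K ⊔ L).nsc = ((m + n : ℕ) : ℕ∞))) ∧
    -- intersection
    ((∀ (α : Type*) (K L : Language α), K.PrefixFree → L.PrefixFree →
          K.nsc = (m : ℕ∞) → L.nsc = (n : ℕ∞) →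
          (K ⊓ L).nsc ≤ ((m * n - (m + n) + 2 : ℕ) : ℕ∞)) ∧
      (∃ K L : Language (Fin 2), K.PrefixFree ∧ L.PrefixFree ∧
          K.nsc = (m : ℕ∞) ∧ L.nsc = (n : ℕ∞) ∧
          (K ⊓ L).nsc = ((m * n - (m + n) + 2 : ℕ) : ℕ∞))) ∧
    -- complement
    ((∀ (α : Type*) (L : Language α), L.PrefixFree → L.nsc = (n : ℕ∞) →
          (Lᶜ).nsc ≤ ((2 ^ (n - 1) : ℕ) : ℕ∞)) ∧
      (∃ L : Language (Fin 3), L.PrefixFree ∧ L.nsc = (n : ℕ∞) ∧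
          (Lᶜ).nsc = ((2 ^ (n - 1) : ℕ) : ℕ∞))) ∧
    -- difference
    ((∀ (α : Type*) (K L : Language α), K.PrefixFree → L.PrefixFree →
          K.nsc = (m : ℕ∞) → L.nsc = (n : ℕ∞) →
          (K \ L).nsc ≤ (((m - 1) * 2 ^ (n - 1) + 1 : ℕ) : ℕ∞)) ∧
      (∃ K L : Language (Fin 4), K.PrefixFree ∧ L.PrefixFree ∧
          K.nsc = (m : ℕ∞) ∧ L.nsc = (n : ℕ∞) ∧
          (K \ L).nsc = (((m - 1) * 2 ^ (n - 1) + 1 : ℕ) : ℕ∞))) := by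
  -- `k` and `l` count the working states; they are at least `2`, as needed for `0 ≠ -1` and for
  -- merging.
  obtain ⟨k, rfl⟩ : ∃ k, m = k + 1 := ⟨m - 1, by omega⟩
  obtain ⟨l, rfl⟩ : ∃ l, n = l + 1 := ⟨n - 1, by omega⟩
  have : NeZero k := ⟨by omega⟩
  have : NeZero l := ⟨by omega⟩
  have hinf : (k + 1) * (l + 1) - (k + 1 + (l + 1)) + 2 = k * l + 1 := by
    have : (k + 1) * (l + 1) = k * l + k + l + 1 := by ring
    have : 0 < k * l := Nat.mul_pos (by omega) (by omega)
    omega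
  refine ⟨⟨?_, ?_⟩, ⟨?_, ?_⟩, ⟨?_, ?_⟩, ⟨?_, ?_⟩⟩
  · intro α K L hK hL hKm hLn
    exact hK.nsc_sup_le hL (by omega) (by omega) hKm hLn
  · have h01 : (0 : Fin 2) ≠ 1 := by decide
    refine ⟨_, _, NFA.cycle_prefixFree h01, NFA.cycle_prefixFree h01.symm,
      NFA.nsc_cycle (k := k) h01, NFA.nsc_cycle (k := l) h01.symm, le_antisymm ?_ ?_⟩
    · exact (NFA.cycle_prefixFree h01).nsc_sup_le (NFA.cycle_prefixFree h01.symm) (by omega)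
        (by omega) (NFA.nsc_cycle h01) (NFA.nsc_cycle h01.symm)
    · rw [show k + 1 + (l + 1) = k + l + 2 by ring]
      exact NFA.le_nsc_cycle_sup_cycle h01
  · intro α K L hK hL hKm hLn
    rw [hinf]
    exact hK.nsc_inf_le hL (by omega) (by omega) hKm hLn
  · have h01 : (0 : Fin 2) ≠ 1 := by decide
    refine ⟨_, _, NFA.gate_prefixFree h01, NFA.counter_prefixFree,
      NFA.nsc_gate (k := k) h01, NFA.nsc_counter (l := l) (b := 1), ?_⟩
    rw [hinf]
    exact le_antisymm ((NFA.gate_prefixFree h01).nsc_inf_le NFA.counter_prefixFree (by omega)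
      (by omega) (NFA.nsc_gate h01) NFA.nsc_counter)
      (NFA.le_nsc_gate_inf_counter (by omega) h01)
  · intro α L hL hLn
    exact hL.nsc_compl_le (by omega) hLn
  · have h01 : (0 : Fin 3) ≠ 1 := by decide
    have h02 : (0 : Fin 3) ≠ 2 := by decide
    have h12 : (1 : Fin 3) ≠ 2 := by decide
    exact ⟨_, NFA.merger_prefixFree h02 h12, NFA.nsc_merger (k := l) h01 h02 h12, le_antisymm
      ((NFA.merger_prefixFree h02 h12).nsc_compl_le (by omega) (NFA.nsc_merger h01 h02 h12))
      (NFA.le_nsc_compl_merger (by omega) h01 h02 h12)⟩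
  · intro α K L hK hL hKm hLn
    exact hK.nsc_sdiff_le hL (by omega) (by omega) hKm hLn
  · have h01 : (0 : Fin 4) ≠ 1 := by decide
    have h02 : (0 : Fin 4) ≠ 2 := by decide
    have h12 : (1 : Fin 4) ≠ 2 := by decide
    have h30 : (3 : Fin 4) ≠ 0 := by decide
    have h31 : (3 : Fin 4) ≠ 1 := by decide
    have h32 : (3 : Fin 4) ≠ 2 := by decide
    exact ⟨_, _, NFA.gate_prefixFree h32, NFA.merger_prefixFree h02 h12,
      NFA.nsc_gate (k := k) h32, NFA.nsc_merger (k := l) h01 h02 h12, le_antisymm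
      ((NFA.gate_prefixFree h32).nsc_sdiff_le (NFA.merger_prefixFree h02 h12) (by omega)
        (by omega) (NFA.nsc_gate h32) (NFA.nsc_merger h01 h02 h12))
      (NFA.le_nsc_gate_sdiff_merger (by omega) (by omega) h01 h02 h12 h30 h31 h32)⟩
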